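/- **Conventions.** Graphs are simple and undirected. A *monomorphism* is an injective homomorphism (it preserves edges, not necessarily non-edges); a *bimorphism* of a graph $\Gamma$ is a bijective homomorphism $\Gamma\to\Gamma$. A graph $\Gamma$ is *MB-homogeneous* if every monomorphism from a finite induced subgraph of $\Gamma$ into $\Gamma$ extends to a bimorphism of $\Gamma$. A *permutation monoid* on a countably infinite set $X$ is a submonoid $T$ of $\mathrm{Sym}(X)$; it is *oligomorphic* if, for every $n\in\mathbb N$, its componentwise action on $X^n$ has only finitely many strong orbits, where the strong orbit of $\bar x\in X^n$ is the set of all $\bar y\in X^n$ such that $s\bar x=\bar y$ and $t\bar y=\bar x$ for some $s,t\in T$. For $n\in\mathbb N$ let $P^n=(p_i)_{i\ge 0}$ be the binary sequence consisting of $n$ ones followed by $0,1,0,1,\dots$; that is, $p_i=0$ if $i\ge n$ and $i-n$ is even, and $p_i=1$ otherwise. Let $\Gamma(P^n)$ be the graph on $\{v_0,v_1,\dots\}$ in which, for $i\neq j$, $v_i\sim v_j$ if and only if $p_{\max(i,j)}=0$. Thus $\{v_0,\dots,v_{n-1}\}$ is an independent set. For a graph $\Delta$ on $n$ vertices, identified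 with $v_0,\dots,v_{n-1}$, let $\Gamma_\Delta$ be the graph obtained from $\Gamma(P^n)$ by adding the edges of $\Delta$ on $\{v_0,\dots,v_{n-1}\}$. **Theorem.** Let $H$ be a finite group. 1. There is a countably infinite MB-homogeneous graph $\Gamma$ with $\mathrm{Aut}(\Gamma)\cong H$. 2. More precisely, there is a $3$-regular graph $\Delta$ on $n\ge 6$ vertices with $\mathrm{Aut}(\Delta)\cong H$; and for every such $\Delta$ the graph $\Gamma_\Delta$ is MB-homogeneous and $\mathrm{Aut}(\Gamma_\Delta)\cong H$. 3. Consequently, there is an oligomorphic permutation monoid on a countably infinite set whose group of units is isomorphic to $H$. -/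

import Mathlib

/-- The bimorphism monoid `Bi(Γ)` of a graph: the bijective endomorphisms of `Γ`
(edges are preserved, non-edges need not be), as a submonoid of the symmetric group. -/
def bimorphismMonoid {V : Type*} (Γ : SimpleGraph V) : Submonoid (Equiv.Perm V) where
  carrier := {g | ∀ u v, Γ.Adj u v → Γ.Adj (g u) (g v)}
  one_mem' := fun _ _ h => h
  mul_mem' := fun {_ _} ha hb _ _ h => ha _ _ (hb _ _ h)

/-- `Γ` is MB-homogeneous: every monomorphism (injective homomorphism) from a finite induced
subgraph of `Γ` into `Γ` extends to a bimorphism of `Γ`. -/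
def IsMBHomogeneous {V : Type*} (Γ : SimpleGraph V) : Prop :=
  ∀ A : Set V, A.Finite → ∀ f : Γ.induce A →g Γ, Function.Injective f →
    ∃ g ∈ bimorphismMonoid Γ, ∀ a : A, g a = f a

/-- The strong orbit of an `n`-tuple `x` under the componentwise action of a
permutation monoid `T`. -/
def strongOrbit {X : Type*} (T : Submonoid (Equiv.Perm X)) {n : ℕ} (x : Fin n → X) :
    Set (Fin n → X) :=
  {y | (∃ s ∈ T, ∀ i, s (x i) = y i) ∧ (∃ t ∈ T, ∀ i, t (y i) = x i)}

/-- A permutation monoid on `X` is oligomorphic if it has finitely many strong orbits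
on `X ^ n` for every `n`. -/
def IsOligomorphic {X : Type*} (T : Submonoid (Equiv.Perm X)) : Prop :=
  ∀ n : ℕ, (Set.range fun x : Fin n → X => strongOrbit T x).Finite

/-- The graph `Γ(P)` determined by a binary sequence `P`: distinct `i`, `j` are adjacent
if and only if `P (max i j) = 0`. -/
def sequenceGraph (P : ℕ → Fin 2) : SimpleGraph ℕ where
  Adj i j := i ≠ j ∧ P (max i j) = 0
  symm := ⟨fun i j h => ⟨h.1.symm, by rw [max_comm]; exact h.2⟩⟩
  loopless := ⟨fun _ h => h.1 rfl⟩

/-- The binary sequence that starts with `n` ones and continues `0, 1, 0, 1, …`. -/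
def blockSequence (n : ℕ) : ℕ → Fin 2 :=
  fun i => if i < n then 1 else if Even (i - n) then 0 else 1

/-- The graph obtained from `Γ(P)`, where `P` is `n` ones followed by `0, 1, 0, 1, …`, by drawing
the edges of `Δ` on the initial independent block `{0, …, n - 1}`. -/
def overlayGraph {n : ℕ} (Δ : SimpleGraph (Fin n)) : SimpleGraph ℕ :=
  sequenceGraph (blockSequence n) ⊔ Δ.map Fin.valEmbedding

/-- Every vertex has exactly three neighbours. -/
def IsThreeRegular {V : Type*} (Δ : SimpleGraph V) : Prop :=
  ∀ v, (Δ.neighborSet v).ncard = 3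

/-! Homogeneity. If every finite vertex set has a cone (an outside vertex adjacent to all of it) and
an anticone (one adjacent to none of it), any finite partial monomorphism grows by back-and-forth to
a bimorphism: a new vertex is sent to a cone over the current image, and a new target is hit from an
anticone over the current domain. In `overlayGraph Δ` the tail vertices at even distance from `n`
are adjacent to everything earlier and those at odd distance to nothing earlier, so cones and
anticones exist whatever `Δ` is. MB-homogeneity leaves finitely many strong orbits of tuples, and
the units of the bimorphism monoid are the automorphisms, so the statement on monoids follows.

Automorphisms. Cubicity and `6 ≤ n` make the even and odd tail vertices recognisable inside the
graph; an induction then shows that an automorphism fixes the tail pointwise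
(`overlayGraph_aut_apply_of_le`). Hence it restricts to `Δ`, and conversely every automorphism of
`Δ` extends by the identity.

Cubic graphs with group `H`. Take a regular cover, with group `H`, of a cubic ladder whose rungs
carry all elements of `H` as voltages. Triangles lift and project, and they rigidify the base so far
that automorphisms of the cover preserve fibres (`LadderVertex.aut_snd`). A fibre-preserving
automorphism is a left multiplication. -/

/-! ### Back-and-forth with cones and anticones -/

/-- A finite set of pairs that is the graph of a monomorphism between induced subgraphs. -/
def IsPartialMono {V : Type*} (Γ : SimpleGraph V) (p : Finset (V × V)) : Prop :=
  ∀ a ∈ p, ∀ b ∈ p, (a.1 = b.1 ↔ a.2 = b.2) ∧ (Γ.Adj a.1 b.1 → Γ.Adj a.2 b.2)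

/-- A cone over the image is adjacent to every old value, so any edge at the new vertex is
preserved. -/
theorem IsPartialMono.exists_extend_dom {V : Type*} [DecidableEq V] {Γ : SimpleGraph V}
    (hcone : ∀ S : Finset V, ∃ x, x ∉ S ∧ ∀ s ∈ S, Γ.Adj x s)
    {p : Finset (V × V)} (hp : IsPartialMono Γ p) (x : V) :
    ∃ q, p ⊆ q ∧ IsPartialMono Γ q ∧ ∃ y, (x, y) ∈ q := by
  by_cases hx : ∃ y, (x, y) ∈ p
  · exact ⟨p, subset_rfl, hp, hx⟩
  obtain ⟨y, hy, hadj⟩ := hcone (p.image Prod.snd)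
  have hy' : ∀ a ∈ p, Γ.Adj y a.2 := fun a ha => hadj _ (Finset.mem_image_of_mem _ ha)
  have hxa : ∀ a ∈ p, a.1 ≠ x := fun a ha h => hx ⟨a.2, by rw [← h]; exact ha⟩
  refine ⟨insert (x, y) p, Finset.subset_insert _ _, ?_, y, Finset.mem_insert_self _ _⟩
  intro a ha b hb
  rcases Finset.mem_insert.1 ha with rfl | ha <;> rcases Finset.mem_insert.1 hb with rfl | hb
  · simp
  · exact ⟨⟨fun h => absurd h.symm (hxa b hb), fun h => absurd h (hy' b hb).ne⟩,
      fun _ => hy' b hb⟩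
  · exact ⟨⟨fun h => absurd h (hxa a ha), fun h => absurd h.symm (hy' a ha).ne⟩,
      fun _ => (hy' a ha).symm⟩
  · exact hp a ha b hb

/-- An anticone over the domain has no edges to old vertices, so there is nothing to preserve,
whatever `y` is. -/
theorem IsPartialMono.exists_extend_range {V : Type*} [DecidableEq V] {Γ : SimpleGraph V}
    (hanti : ∀ S : Finset V, ∃ x, x ∉ S ∧ ∀ s ∈ S, ¬ Γ.Adj x s)
    {p : Finset (V × V)} (hp : IsPartialMono Γ p) (y : V) :
    ∃ q, p ⊆ q ∧ IsPartialMono Γ q ∧ ∃ x, (x, y) ∈ q := by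
  by_cases hy : ∃ x, (x, y) ∈ p
  · exact ⟨p, subset_rfl, hp, hy⟩
  obtain ⟨x, hx, hadj⟩ := hanti (p.image Prod.fst)
  have hx' : ∀ a ∈ p, ¬ Γ.Adj x a.1 := fun a ha => hadj _ (Finset.mem_image_of_mem _ ha)
  have hxa : ∀ a ∈ p, a.1 ≠ x := fun a ha h => hx (h ▸ Finset.mem_image_of_mem _ ha)
  have hya : ∀ a ∈ p, a.2 ≠ y := fun a ha h => hy ⟨a.1, by rw [← h]; exact ha⟩
  refine ⟨insert (x, y) p, Finset.subset_insert _ _, ?_, x, Finset.mem_insert_self _ _⟩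
  intro a ha b hb
  rcases Finset.mem_insert.1 ha with rfl | ha <;> rcases Finset.mem_insert.1 hb with rfl | hb
  · simp
  · exact ⟨⟨fun h => absurd h.symm (hxa b hb), fun h => absurd h.symm (hya b hb)⟩,
      fun h => absurd h (hx' b hb)⟩
  · exact ⟨⟨fun h => absurd h (hxa a ha), fun h => absurd h (hya a ha)⟩,
      fun h => absurd h.symm (hx' a ha)⟩
  · exact hp a ha b hb

/-- Back-and-forth: every finite partial monomorphism is part of a bimorphism. -/
theorem IsPartialMono.exists_bimorphism {Γ : SimpleGraph ℕ}
    (hcone : ∀ S : Finset ℕ, ∃ x, x ∉ S ∧ ∀ s ∈ S, Γ.Adj x s)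
    (hanti : ∀ S : Finset ℕ, ∃ x, x ∉ S ∧ ∀ s ∈ S, ¬ Γ.Adj x s)
    {p : Finset (ℕ × ℕ)} (hp : IsPartialMono Γ p) :
    ∃ g ∈ bimorphismMonoid Γ, ∀ a ∈ p, g a.1 = a.2 := by
  have step : ∀ (q : {q // IsPartialMono Γ q}) (m : ℕ), ∃ r : {q // IsPartialMono Γ q},
      q.1 ⊆ r.1 ∧ (∃ y, (m, y) ∈ r.1) ∧ ∃ x, (x, m) ∈ r.1 := by
    rintro ⟨q, hq⟩ m
    obtain ⟨q₁, h₁, hq₁, y, hy⟩ := hq.exists_extend_dom hcone m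
    obtain ⟨q₂, h₂, hq₂, x, hx⟩ := hq₁.exists_extend_range hanti m
    exact ⟨⟨q₂, hq₂⟩, h₁.trans h₂, ⟨y, h₂ hy⟩, x, hx⟩
  choose next hsub hdom hran using step
  let s : ℕ → {q // IsPartialMono Γ q} := fun m => Nat.rec ⟨p, hp⟩ (fun m q => next q m) m
  have hs : ∀ m, s (m + 1) = next (s m) m := fun _ => rfl
  have hmono : Monotone fun m => (s m).1 :=
    monotone_nat_of_le_succ fun m => by simpa only [hs] using hsub (s m) m
  -- Two pairs from any stages lie in a common later stage, so the union of the chain is again a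
  -- partial monomorphism.
  have key : ∀ a b : ℕ × ℕ, (∃ i, a ∈ (s i).1) → (∃ j, b ∈ (s j).1) →
      (a.1 = b.1 ↔ a.2 = b.2) ∧ (Γ.Adj a.1 b.1 → Γ.Adj a.2 b.2) := fun a b ⟨i, ha⟩ ⟨j, hb⟩ =>
    (s (max i j)).2 a (hmono (le_max_left i j) ha) b (hmono (le_max_right i j) hb)
  have hf : ∀ m, ∃ y, ∃ i, (m, y) ∈ (s i).1 := fun m =>
    (hdom (s m) m).imp fun _ h => ⟨m + 1, h⟩
  have hf' : ∀ m, ∃ x, ∃ i, (x, m) ∈ (s i).1 := fun m =>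
    (hran (s m) m).imp fun _ h => ⟨m + 1, h⟩
  choose f hf using hf
  choose f' hf' using hf'
  refine ⟨⟨f, f', fun m => ?_, fun m => ?_⟩, ?_, ?_⟩
  · exact (key _ _ (hf' (f m)) (hf m)).1.2 rfl
  · exact (key _ _ (hf (f' m)) (hf' m)).1.1 rfl
  · exact fun u v huv => (key _ _ (hf u) (hf v)).2 huv
  · exact fun a ha => (key _ _ (hf a.1) ⟨0, ha⟩).1.1 rfl

theorem isMBHomogeneous_of_cone_of_anticone {Γ : SimpleGraph ℕ}
    (hcone : ∀ S : Finset ℕ, ∃ x, x ∉ S ∧ ∀ s ∈ S, Γ.Adj x s)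
    (hanti : ∀ S : Finset ℕ, ∃ x, x ∉ S ∧ ∀ s ∈ S, ¬ Γ.Adj x s) :
    IsMBHomogeneous Γ := by
  intro A hA f hf
  have : Finite A := hA
  have : Fintype A := Fintype.ofFinite A
  have hp : IsPartialMono Γ (Finset.univ.image fun a : A => ((a : ℕ), f a)) := by
    intro a ha b hb
    obtain ⟨x, -, rfl⟩ := Finset.mem_image.1 ha
    obtain ⟨y, -, rfl⟩ := Finset.mem_image.1 hb
    exact ⟨by rw [Subtype.coe_inj, hf.eq_iff], fun h => f.map_adj (v := x) (w := y) h⟩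
  obtain ⟨g, hg, h⟩ := hp.exists_bimorphism hcone hanti
  exact ⟨g, hg, fun a => h _ (Finset.mem_image_of_mem _ (Finset.mem_univ a))⟩

/-! ### Strong orbits and units of the bimorphism monoid -/

theorem IsMBHomogeneous.exists_map_tuple {V : Type*} {Γ : SimpleGraph V} (hΓ : IsMBHomogeneous Γ)
    {n : ℕ} {x y : Fin n → V} (heq : ∀ i j, x i = x j ↔ y i = y j)
    (hadj : ∀ i j, Γ.Adj (x i) (x j) → Γ.Adj (y i) (y j)) :
    ∃ s ∈ bimorphismMonoid Γ, ∀ i, s (x i) = y i := by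
  choose c hc using fun a : Set.range x => a.2
  have hy : ∀ i, y (c ⟨x i, i, rfl⟩) = y i := fun i => (heq _ _).1 (hc ⟨x i, i, rfl⟩)
  let f : Γ.induce (Set.range x) →g Γ :=
    { toFun := fun a => y (c a)
      map_rel' := fun {a b} h => hadj _ _ (by rw [hc, hc]; exact h) }
  obtain ⟨g, hg, h⟩ := hΓ (Set.range x) (Set.finite_range x) f fun a b hab => by
    have h := (heq _ _).2 hab
    rw [hc, hc] at h
    exact Subtype.ext h
  exact ⟨g, hg, fun i => (h ⟨x i, i, rfl⟩).trans (hy i)⟩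

theorem strongOrbit_subset {X : Type*} {T : Submonoid (Equiv.Perm X)} {n : ℕ} {x y : Fin n → X}
    (h : y ∈ strongOrbit T x) : strongOrbit T y ⊆ strongOrbit T x := by
  obtain ⟨⟨s, hs, hsx⟩, t, ht, hty⟩ := h
  rintro z ⟨⟨s', hs', hs'y⟩, t', ht', ht'z⟩
  exact ⟨⟨s' * s, T.mul_mem hs' hs, fun i => by simp [hsx, hs'y]⟩,
    t * t', T.mul_mem ht ht', fun i => by simp [hty, ht'z]⟩

theorem strongOrbit_eq {X : Type*} {T : Submonoid (Equiv.Perm X)} {n : ℕ} {x y : Fin n → X}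
    (h : y ∈ strongOrbit T x) : strongOrbit T x = strongOrbit T y :=
  (strongOrbit_subset ⟨h.2, h.1⟩).antisymm (strongOrbit_subset h)

/-- The strong orbit of a tuple depends only on its pattern of equalities and adjacencies, and for
fixed length there are finitely many patterns. -/
theorem IsMBHomogeneous.isOligomorphic {V : Type*} {Γ : SimpleGraph V} (hΓ : IsMBHomogeneous Γ) :
    IsOligomorphic (bimorphismMonoid Γ) := by
  intro n
  let type : (Fin n → V) → (Fin n → Fin n → Prop) × (Fin n → Fin n → Prop) :=
    fun x => (fun i j => x i = x j, fun i j => Γ.Adj (x i) (x j))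
  have hfac : Function.FactorsThrough
      (fun x : Fin n → V => strongOrbit (bimorphismMonoid Γ) x) type := by
    intro x y hxy
    have h₁ : ∀ i j, x i = x j ↔ y i = y j := fun i j =>
      iff_of_eq (congrFun (congrFun (congrArg Prod.fst hxy) i) j)
    have h₂ : ∀ i j, Γ.Adj (x i) (x j) ↔ Γ.Adj (y i) (y j) := fun i j =>
      iff_of_eq (congrFun (congrFun (congrArg Prod.snd hxy) i) j)
    exact strongOrbit_eq ⟨hΓ.exists_map_tuple h₁ fun i j => (h₂ i j).1,
      hΓ.exists_map_tuple (fun i j => (h₁ i j).symm) fun i j => (h₂ i j).2⟩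
  obtain ⟨e, he⟩ := (Function.factorsThrough_iff _).1 hfac
  rw [he]
  exact (Set.finite_range e).subset (Set.range_comp_subset_range type e)

/-- The units of the bimorphism monoid are the automorphisms. -/
def bimorphismUnitsEquiv {V : Type*} (Γ : SimpleGraph V) :
    (bimorphismMonoid Γ)ˣ ≃* (Γ ≃g Γ) where
  toFun u :=
    { toEquiv := u.1.1
      map_rel_iff' := fun {a b} => by
        refine ⟨fun h => ?_, u.1.2 a b⟩
        have hinv : ∀ c, u⁻¹.1.1 (u.1.1 c) = c := fun c =>
          congrArg (fun w : bimorphismMonoid Γ => w.1 c) u.inv_mul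
        simpa only [hinv] using u⁻¹.1.2 _ _ h }
  invFun φ :=
    { val := ⟨φ.toEquiv, fun _ _ h => φ.map_rel_iff.2 h⟩
      inv := ⟨φ.symm.toEquiv, fun _ _ h => φ.symm.map_rel_iff.2 h⟩
      val_inv := Subtype.ext (Equiv.ext fun x => φ.apply_symm_apply x)
      inv_val := Subtype.ext (Equiv.ext fun x => φ.symm_apply_apply x) }
  left_inv _ := Units.ext rfl
  right_inv _ := rfl
  map_mul' _ _ := rfl

/-! ### Adjacency and homogeneity of the overlay graph -/

section Overlay
variable {n : ℕ} {Δ : SimpleGraph (Fin n)}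

theorem overlayGraph_adj_iff {i j : ℕ} : (overlayGraph Δ).Adj i j ↔
    (i ≠ j ∧ n ≤ max i j ∧ Even (max i j - n)) ∨ ∃ a b, Δ.Adj a b ∧ a.1 = i ∧ b.1 = j := by
  simp only [overlayGraph, sequenceGraph, blockSequence, SimpleGraph.sup_adj]
  refine or_congr (and_congr_right fun _ => ?_) (SimpleGraph.map_adj Fin.valEmbedding _ _ _)
  rcases lt_or_ge (max i j) n with h | h
  · rw [if_pos h]
    exact iff_of_false (by decide) fun h' => absurd h'.1 h.not_ge
  · rw [if_neg h.not_gt]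
    split_ifs with h' <;> simp [h, h']

theorem overlayGraph_adj_of_lt {i j : ℕ} (hj : n ≤ j) (hij : i < j) :
    (overlayGraph Δ).Adj i j ↔ Even (j - n) := by
  rw [overlayGraph_adj_iff, max_eq_right hij.le]
  constructor
  · rintro (h | ⟨a, b, -, -, h⟩)
    · exact h.2.2
    · exact absurd b.2 (by omega)
  · exact fun h => Or.inl ⟨hij.ne, hj, h⟩

theorem overlayGraph_adj_val {i j : Fin n} : (overlayGraph Δ).Adj i j ↔ Δ.Adj i j := by
  rw [overlayGraph_adj_iff]
  constructor
  · rintro (h | ⟨a, b, h, ha, hb⟩)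
    · exact absurd h.2.1 (by simp)
    · rwa [← Fin.ext ha, ← Fin.ext hb]
  · exact fun h => Or.inr ⟨i, j, h, rfl, rfl⟩

/-- The hypothesis `hj` is vacuous for `j` in the block, so block vertices and even tail vertices
are treated together. -/
theorem overlayGraph_adj_even {i j : ℕ} (hi : n ≤ i) (hi' : Even (i - n)) (hij : i ≠ j)
    (hj : n ≤ j → Even (j - n)) : (overlayGraph Δ).Adj i j := by
  rcases lt_or_gt_of_ne hij with h | h
  · exact (overlayGraph_adj_of_lt (hi.trans h.le) h).2 (hj (hi.trans h.le))
  · exact ((overlayGraph_adj_of_lt hi h).2 hi').symm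

/-- An even tail vertex beyond `S` is a cone over `S`, an odd one an anticone. -/
theorem overlayGraph_isMBHomogeneous (Δ : SimpleGraph (Fin n)) :
    IsMBHomogeneous (overlayGraph Δ) := by
  refine isMBHomogeneous_of_cone_of_anticone (fun S => ?_) fun S => ?_
  · have hlt : ∀ s ∈ S, s < n + 2 * (S.sup id + 1) := fun s hs => by
      have := Finset.le_sup (f := id) hs
      simp only [id] at this
      omega
    refine ⟨n + 2 * (S.sup id + 1), fun h => (hlt _ h).false, fun s hs => SimpleGraph.Adj.symm ?_⟩
    rw [overlayGraph_adj_of_lt (by omega) (hlt s hs)]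
    simp
  · have hlt : ∀ s ∈ S, s < n + (2 * S.sup id + 1) := fun s hs => by
      have := Finset.le_sup (f := id) hs
      simp only [id] at this
      omega
    refine ⟨n + (2 * S.sup id + 1), fun h => (hlt _ h).false, fun s hs => ?_⟩
    rw [SimpleGraph.adj_comm, overlayGraph_adj_of_lt (by omega) (hlt s hs)]
    simp

/-! ### Automorphisms of the overlay graph -/

/-- The neighbours of `x` are pairwise adjacent. -/
def HasCliqueNeighbors {V : Type*} (Γ : SimpleGraph V) (x : V) : Prop :=
  ∀ y z, Γ.Adj x y → Γ.Adj x z → y ≠ z → Γ.Adj y z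

/-- The neighbours of `x` are pairwise adjacent, and none of them has this property. -/
def IsIsolatedSimplicial {V : Type*} (Γ : SimpleGraph V) (x : V) : Prop :=
  HasCliqueNeighbors Γ x ∧ ∀ y, Γ.Adj x y → ¬ HasCliqueNeighbors Γ y

theorem HasCliqueNeighbors.map {V : Type*} {Γ : SimpleGraph V} (φ : Γ ≃g Γ) {x : V}
    (h : HasCliqueNeighbors Γ x) : HasCliqueNeighbors Γ (φ x) := by
  intro y z hy hz hyz
  obtain ⟨y, rfl⟩ := φ.surjective y
  obtain ⟨z, rfl⟩ := φ.surjective z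
  rw [φ.map_adj_iff] at hy hz ⊢
  exact h y z hy hz fun h => hyz (h ▸ rfl)

theorem IsIsolatedSimplicial.map {V : Type*} {Γ : SimpleGraph V} (φ : Γ ≃g Γ) {x : V}
    (h : IsIsolatedSimplicial Γ x) : IsIsolatedSimplicial Γ (φ x) := by
  refine ⟨h.1.map φ, fun y hy hc => ?_⟩
  obtain ⟨y, rfl⟩ := φ.surjective y
  refine h.2 y (φ.map_adj_iff.1 hy) ?_
  simpa using hc.map φ.symm

theorem isIsolatedSimplicial_map_iff {V : Type*} {Γ : SimpleGraph V} (φ : Γ ≃g Γ) {x : V} :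
    IsIsolatedSimplicial Γ (φ x) ↔ IsIsolatedSimplicial Γ x :=
  ⟨fun h => by simpa using h.map φ.symm, fun h => h.map φ⟩

theorem IsThreeRegular.exists_not_adj (hΔ : IsThreeRegular Δ) (hn : 6 ≤ n) (b : Fin n) :
    ∃ c, c ≠ b ∧ ¬ Δ.Adj b c := by
  by_contra! h
  have h₁ : (Set.univ : Set (Fin n)) ⊆ insert b (Δ.neighborSet b) := fun c _ => by
    by_cases hc : c = b
    · exact Or.inl hc
    · exact Or.inr (h c hc)
  have h₂ := (Set.ncard_le_ncard h₁).trans (Set.ncard_insert_le _ _)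
  rw [hΔ b, Set.ncard_univ, Nat.card_fin] at h₂
  omega

/-- The closed neighbourhood of `x` is a `K₄`, and by regularity it already contains all neighbours
of `y`. -/
theorem IsThreeRegular.hasCliqueNeighbors_of_adj {V : Type*} [Finite V] {Δ : SimpleGraph V}
    (hΔ : IsThreeRegular Δ) {x y : V} (hx : HasCliqueNeighbors Δ x) (hxy : Δ.Adj x y) :
    HasCliqueNeighbors Δ y := by
  have hsub : insert x (Δ.neighborSet x \ {y}) ⊆ Δ.neighborSet y := by
    rintro z (rfl | ⟨hz, hzy⟩)
    · exact hxy.symm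
    · exact hx y z hxy hz (Ne.symm hzy)
  have hcard : (insert x (Δ.neighborSet x \ {y})).ncard = 3 := by
    rw [Set.ncard_insert_of_notMem (fun h => Δ.loopless.irrefl x h.1),
      Set.ncard_sdiff_singleton_of_mem (show y ∈ Δ.neighborSet x from hxy), hΔ]
  have heq := Set.eq_of_subset_of_ncard_le hsub (by rw [hΔ, hcard])
  intro u v hu hv huv
  rw [← SimpleGraph.mem_neighborSet, ← heq] at hu hv
  rcases hu with rfl | hu <;> rcases hv with rfl | hv
  · exact absurd rfl huv
  · exact hv.1
  · exact hu.1.symm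
  · exact hx u v hu.1 hv.1 huv

theorem not_hasCliqueNeighbors_overlayGraph (hn : 6 ≤ n) (hΔ : IsThreeRegular Δ) {x : ℕ}
    (hx : n ≤ x) (hx' : Even (x - n)) : ¬ HasCliqueNeighbors (overlayGraph Δ) x := by
  intro h
  obtain ⟨c, hc, hbc⟩ := hΔ.exists_not_adj hn ⟨0, by omega⟩
  refine hbc (overlayGraph_adj_val.1 (h _ _ ?_ ?_ fun h => hc (Fin.ext h.symm)))
  · exact ((overlayGraph_adj_of_lt hx (by simp; omega)).2 hx').symm
  · exact ((overlayGraph_adj_of_lt hx (by omega)).2 hx').symm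

/-- The neighbours of an odd tail vertex are the later even ones: a clique, each member of which
sees two non-adjacent block vertices. A block vertex with clique neighbourhood lies in a `K₄` of
`Δ`, so its neighbours in `Δ` have clique neighbourhoods too; this is why the second clause of
`IsIsolatedSimplicial` is needed. -/
theorem isIsolatedSimplicial_overlayGraph_iff (hn : 6 ≤ n) (hΔ : IsThreeRegular Δ) {x : ℕ} :
    IsIsolatedSimplicial (overlayGraph Δ) x ↔ n ≤ x ∧ ¬ Even (x - n) := by
  constructor
  · intro h
    have hx : n ≤ x := by
      by_contra! hx
      obtain ⟨y, hy⟩ : (Δ.neighborSet ⟨x, hx⟩).Nonempty := by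
        apply Set.nonempty_of_ncard_ne_zero
        rw [hΔ]
        decide
      have hxc : HasCliqueNeighbors Δ ⟨x, hx⟩ := fun u v hu hv huv =>
        overlayGraph_adj_val.1 (h.1 _ _ (overlayGraph_adj_val.2 hu) (overlayGraph_adj_val.2 hv)
          fun h => huv (Fin.ext h))
      have hyc := hΔ.hasCliqueNeighbors_of_adj hxc hy
      have hev : ∀ u, n ≤ u → (overlayGraph Δ).Adj y u → Even (u - n) := fun u hu h =>
        (overlayGraph_adj_of_lt hu (by omega)).1 h
      refine h.2 y (overlayGraph_adj_val.2 hy) fun u v hu hv huv => ?_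
      rcases le_or_gt n u with hnu | hnu
      · exact overlayGraph_adj_even hnu (hev u hnu hu) huv fun hnv => hev v hnv hv
      rcases le_or_gt n v with hnv | hnv
      · exact (overlayGraph_adj_even hnv (hev v hnv hv) huv.symm fun hnu => hev u hnu hu).symm
      lift u to Fin n using hnu
      lift v to Fin n using hnv
      exact overlayGraph_adj_val.2 (hyc u v (overlayGraph_adj_val.1 hu)
        (overlayGraph_adj_val.1 hv) fun h => huv (h ▸ rfl))
    exact ⟨hx, fun hev => not_hasCliqueNeighbors_overlayGraph hn hΔ hx hev h.1⟩
  · rintro ⟨hx, hodd⟩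
    have hnb : ∀ y, (overlayGraph Δ).Adj x y → n ≤ y ∧ Even (y - n) := by
      intro y hy
      rcases lt_or_gt_of_ne hy.ne with h | h
      · exact ⟨hx.trans h.le, (overlayGraph_adj_of_lt (hx.trans h.le) h).1 hy⟩
      · exact absurd ((overlayGraph_adj_of_lt hx h).1 hy.symm) hodd
    exact ⟨fun y z hy hz hyz => overlayGraph_adj_even (hnb y hy).1 (hnb y hy).2 hyz
        fun _ => (hnb z hz).2,
      fun y hy => not_hasCliqueNeighbors_overlayGraph hn hΔ (hnb y hy).1 (hnb y hy).2⟩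

/-- With the odd tail discarded, the even tail vertices are exactly those adjacent to all others; a
block vertex misses some other block vertex. -/
theorem overlayGraph_dominates_iff (hn : 6 ≤ n) (hΔ : IsThreeRegular Δ) {x : ℕ} :
    (¬ IsIsolatedSimplicial (overlayGraph Δ) x ∧ ∀ y, y ≠ x →
      ¬ IsIsolatedSimplicial (overlayGraph Δ) y → (overlayGraph Δ).Adj x y) ↔
    n ≤ x ∧ Even (x - n) := by
  simp only [isIsolatedSimplicial_overlayGraph_iff hn hΔ, not_and, not_not]
  constructor
  · rintro ⟨h₁, h₂⟩
    have hx : n ≤ x := by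
      by_contra! hx
      obtain ⟨c, hc, hbc⟩ := hΔ.exists_not_adj hn ⟨x, hx⟩
      exact hbc (overlayGraph_adj_val.1 (h₂ c (fun h => hc (Fin.ext h)) fun h =>
        absurd c.2 (by omega)))
    exact ⟨hx, h₁ hx⟩
  · rintro ⟨hx, hev⟩
    exact ⟨fun _ => hev, fun y hy hy' => overlayGraph_adj_even hx hev hy.symm hy'⟩

theorem overlayGraph_even_map_iff (hn : 6 ≤ n) (hΔ : IsThreeRegular Δ)
    (φ : overlayGraph Δ ≃g overlayGraph Δ) {x : ℕ} :
    (n ≤ φ x ∧ Even (φ x - n)) ↔ n ≤ x ∧ Even (x - n) := by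
  -- Surjectivity of `φ` lets the quantified vertex be written as `φ y`, after which every clause is
  -- invariant.
  rw [← overlayGraph_dominates_iff hn hΔ, ← overlayGraph_dominates_iff hn hΔ,
    isIsolatedSimplicial_map_iff, φ.surjective.forall]
  simp only [isIsolatedSimplicial_map_iff, φ.map_adj_iff, φ.injective.ne_iff]

theorem overlayGraph_odd_map_iff (hn : 6 ≤ n) (hΔ : IsThreeRegular Δ)
    (φ : overlayGraph Δ ≃g overlayGraph Δ) {x : ℕ} :
    (n ≤ φ x ∧ ¬ Even (φ x - n)) ↔ n ≤ x ∧ ¬ Even (x - n) := by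
  rw [← isIsolatedSimplicial_overlayGraph_iff hn hΔ, isIsolatedSimplicial_map_iff,
    isIsolatedSimplicial_overlayGraph_iff hn hΔ]

theorem overlayGraph_aut_parity (hn : 6 ≤ n) (hΔ : IsThreeRegular Δ)
    (φ : overlayGraph Δ ≃g overlayGraph Δ) {i : ℕ} (hi : n ≤ i) :
    n ≤ φ i ∧ (Even (φ i - n) ↔ Even (i - n)) := by
  by_cases h : Even (i - n)
  · have := (overlayGraph_even_map_iff hn hΔ φ).2 ⟨hi, h⟩
    exact ⟨this.1, iff_of_true this.2 h⟩
  · have := (overlayGraph_odd_map_iff hn hΔ φ).2 ⟨hi, h⟩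
    exact ⟨this.1, iff_of_false this.2 h⟩

theorem overlayGraph_aut_apply_of_le (hn : 6 ≤ n) (hΔ : IsThreeRegular Δ)
    (φ : overlayGraph Δ ≃g overlayGraph Δ) {i : ℕ} (hi : n ≤ i) : φ i = i := by
  induction i using Nat.strong_induction_on with
  | _ i ih =>
  obtain ⟨hφi, hpar⟩ := overlayGraph_aut_parity hn hΔ φ hi
  have hge : i ≤ φ i := by
    by_contra! h
    exact h.ne (φ.injective (ih _ h hφi))
  by_contra hne
  -- `φ i` has the parity of `i`, so it skips `i + 1`. The preimage `y` of `i + 1` is a tail vertex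
  -- of the other parity. As `i + 1 < φ i`, the parity of `i` decides whether `y` and `i` are
  -- adjacent; but if `i < y`, the opposite parity of `y` decides it.
  have hlt : i + 1 < φ i := by
    rw [Nat.even_iff, Nat.even_iff] at hpar
    omega
  obtain ⟨y, hy⟩ := φ.surjective (i + 1)
  have hparS : Even (φ y - n) ↔ ¬ Even (i - n) := by
    rw [hy, Nat.sub_add_comm hi, Nat.even_add_one]
  obtain ⟨hny, hpary⟩ := overlayGraph_aut_parity hn hΔ φ.symm (i := φ y) (by omega)
  rw [φ.symm_apply_apply] at hny hpary
  rw [hparS] at hpary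
  have hadj : (overlayGraph Δ).Adj y i ↔ Even (i - n) := by
    rw [← φ.map_adj_iff, hy, overlayGraph_adj_of_lt hφi hlt, hpar]
  rcases lt_trichotomy y i with h | h | h
  · have := ih y h hny
    omega
  · rw [h] at hpary
    tauto
  · rw [SimpleGraph.adj_comm, overlayGraph_adj_of_lt hny h] at hadj
    tauto

/-- Extension of an automorphism of the initial block by the identity. -/
noncomputable def overlayAutHom (Δ : SimpleGraph (Fin n)) : (Δ ≃g Δ) →* (overlayGraph Δ ≃g overlayGraph Δ) where
  toFun ψ :=
    { toEquiv := Equiv.Perm.viaEmbedding ψ.toEquiv Fin.valEmbedding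
      map_rel_iff' := fun {i j} => by
        have hlow : ∀ a : Fin n, Equiv.Perm.viaEmbedding ψ.toEquiv Fin.valEmbedding (a : ℕ) = ψ a :=
          fun a => Equiv.Perm.viaEmbedding_apply _ Fin.valEmbedding a
        have hhigh : ∀ i, n ≤ i → Equiv.Perm.viaEmbedding ψ.toEquiv Fin.valEmbedding i = i := fun i hi =>
          Equiv.Perm.viaEmbedding_apply_of_notMem _ Fin.valEmbedding i (by
            rintro ⟨a, ha⟩
            exact absurd a.2 (by rw [← Fin.valEmbedding_apply, ha]; omega))
        rcases lt_or_ge i n with hi | hi <;> rcases lt_or_ge j n with hj | hj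
        · lift i to Fin n using hi
          lift j to Fin n using hj
          rw [hlow, hlow, overlayGraph_adj_val, overlayGraph_adj_val]
          exact ψ.map_adj_iff
        · lift i to Fin n using hi
          rw [hlow, hhigh j hj, overlayGraph_adj_of_lt hj (by omega),
            overlayGraph_adj_of_lt hj (by omega)]
        · lift j to Fin n using hj
          rw [hlow, hhigh i hi, SimpleGraph.adj_comm, overlayGraph_adj_of_lt hi (by omega),
            SimpleGraph.adj_comm, overlayGraph_adj_of_lt hi (by omega)]
        · rw [hhigh i hi, hhigh j hj] }
  map_one' := by
    apply RelIso.toEquiv_injective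
    exact map_one (Equiv.Perm.viaEmbeddingHom Fin.valEmbedding)
  map_mul' a b := by
    apply RelIso.toEquiv_injective
    exact map_mul (Equiv.Perm.viaEmbeddingHom Fin.valEmbedding) a.toEquiv b.toEquiv

theorem overlayAutHom_apply_val (ψ : Δ ≃g Δ) (a : Fin n) : overlayAutHom Δ ψ (a : ℕ) = ψ a :=
  Equiv.Perm.viaEmbedding_apply _ Fin.valEmbedding a

/-- Since the tail is fixed pointwise, injectivity keeps the block inside itself, and restriction to
the block is the inverse. -/
theorem overlayAutHom_bijective (hn : 6 ≤ n) (hΔ : IsThreeRegular Δ) :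
    Function.Bijective (overlayAutHom Δ) := by
  refine ⟨fun ψ ψ' h => RelIso.ext fun a => Fin.ext ?_, fun φ => ?_⟩
  · rw [← overlayAutHom_apply_val, h, overlayAutHom_apply_val]
  have hlt : ∀ (φ : overlayGraph Δ ≃g overlayGraph Δ) (a : Fin n), φ a < n := fun φ a => by
    by_contra! h
    have := φ.injective (overlayGraph_aut_apply_of_le hn hΔ φ h)
    omega
  refine ⟨{ toFun := fun a => ⟨φ a, hlt φ a⟩, invFun := fun a => ⟨φ.symm a, hlt φ.symm a⟩,
            left_inv := fun a => by simp, right_inv := fun a => by simp,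
            map_rel_iff' := fun {a b} => ?_ }, RelIso.ext fun i => ?_⟩
  · rw [← overlayGraph_adj_val]
    exact φ.map_adj_iff.trans overlayGraph_adj_val
  · rcases lt_or_ge i n with hi | hi
    · lift i to Fin n using hi
      rw [overlayAutHom_apply_val]
      rfl
    · rw [overlayGraph_aut_apply_of_le hn hΔ _ hi, overlayGraph_aut_apply_of_le hn hΔ _ hi]

end Overlay

/-! ### Regular covers from voltage assignments -/

section VoltageGraph
variable {W H : Type*} [Group H]

/-- The covering graph of `B` on `H × W` determined by a voltage assignment. -/
def voltageGraph (B : SimpleGraph W) (vol : W → W → H) (hvol : ∀ u w, vol w u = (vol u w)⁻¹) :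
    SimpleGraph (H × W) where
  Adj x y := B.Adj x.2 y.2 ∧ y.1 = x.1 * vol x.2 y.2
  symm := ⟨fun x y h => ⟨h.1.symm, by rw [h.2, hvol x.2 y.2, mul_inv_cancel_right]⟩⟩
  loopless := ⟨fun _ h => B.loopless.irrefl _ h.1⟩

variable {B : SimpleGraph W} {vol : W → W → H} {hvol : ∀ u w, vol w u = (vol u w)⁻¹}

theorem voltageGraph_adj {x y : H × W} : (voltageGraph B vol hvol).Adj x y ↔
    B.Adj x.2 y.2 ∧ y.1 = x.1 * vol x.2 y.2 := Iff.rfl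

theorem isThreeRegular_voltageGraph (hB : IsThreeRegular B) :
    IsThreeRegular (voltageGraph B vol hvol) := by
  intro x
  rw [← hB x.2, ← Set.InjOn.ncard_image (f := Prod.snd)]
  · congr 1
    ext w
    constructor
    · rintro ⟨y, hy, rfl⟩
      exact hy.1
    · exact fun hw => ⟨(x.1 * vol x.2 w, w), ⟨hw, rfl⟩, rfl⟩
  · intro y hy z hz hyz
    exact Prod.ext (by rw [hy.2, hz.2, hyz]) hyz

/-- `x` lies in a triangle. -/
def InTriangle {V : Type*} (Γ : SimpleGraph V) (x : V) : Prop :=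
  ∃ y z, Γ.Adj x y ∧ Γ.Adj x z ∧ Γ.Adj y z

theorem InTriangle.map {V V' : Type*} {Γ : SimpleGraph V} {Γ' : SimpleGraph V'} (φ : Γ →g Γ')
    {x : V} (h : InTriangle Γ x) : InTriangle Γ' (φ x) := by
  obtain ⟨y, z, h₁, h₂, h₃⟩ := h
  exact ⟨φ y, φ z, φ.map_adj h₁, φ.map_adj h₂, φ.map_adj h₃⟩

theorem InTriangle.of_voltageGraph {x : H × W} (h : InTriangle (voltageGraph B vol hvol) x) :
    InTriangle B x.2 := by
  obtain ⟨y, z, h₁, h₂, h₃⟩ := h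
  exact ⟨y.2, z.2, h₁.1, h₂.1, h₃.1⟩

/-- Left multiplication acts on the covering graph. -/
def voltageGraphAutHom (B : SimpleGraph W) (vol : W → W → H)
    (hvol : ∀ u w, vol w u = (vol u w)⁻¹) :
    H →* (voltageGraph B vol hvol ≃g voltageGraph B vol hvol) where
  toFun h :=
    { toEquiv := (Equiv.mulLeft h).prodCongr (Equiv.refl W)
      map_rel_iff' := fun {x y} => by
        simp [voltageGraph_adj, mul_assoc] }
  map_one' := RelIso.ext fun x => Prod.ext (one_mul x.1) rfl
  map_mul' h k := RelIso.ext fun x => Prod.ext (mul_assoc h k x.1) rfl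

theorem voltageGraphAutHom_apply (h : H) (x : H × W) :
    voltageGraphAutHom B vol hvol h x = (h * x.1, x.2) := rfl

/-- A fibre-preserving `φ` acts on each fibre by a map of `H`. Edges of trivial voltage make these
maps equal, and connectedness (`hconn`) makes all of them one map `σ`. An edge of voltage `k` gives
`σ (h * k) = σ h * k`; as every `k` occurs (`hgen`), `σ` is left multiplication by `σ 1`. -/
theorem voltageGraphAutHom_bijective (w₀ : W)
    (htype : ∀ (φ : voltageGraph B vol hvol ≃g voltageGraph B vol hvol) x, (φ x).2 = x.2)
    (hconn : ∀ P : W → Prop, P w₀ →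
      (∀ u w, B.Adj u w → vol u w = 1 → P u → P w) → ∀ w, P w)
    (hgen : ∀ h, ∃ u w, B.Adj u w ∧ vol u w = h) :
    Function.Bijective (voltageGraphAutHom B vol hvol) := by
  constructor
  · intro h k hhk
    have := congrArg Prod.fst (congrArg (fun φ => φ ((1 : H), w₀)) hhk)
    simpa [voltageGraphAutHom_apply] using this
  · intro φ
    have hstep : ∀ h u w, B.Adj u w → (φ (h * vol u w, w)).1 = (φ (h, u)).1 * vol u w := by
      intro h u w huw
      have h₁ : (voltageGraph B vol hvol).Adj (h, u) (h * vol u w, w) := ⟨huw, rfl⟩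
      have h₂ := (φ.map_adj_iff.2 h₁).2
      rwa [htype, htype] at h₂
    have hfib : ∀ w h, (φ (h, w)).1 = (φ (h, w₀)).1 := by
      refine hconn _ (fun _ => rfl) fun u w huw hv hu h => ?_
      have := hstep h u w huw
      rwa [hv, mul_one, mul_one, hu] at this
    have hmul : ∀ h k, (φ (h * k, w₀)).1 = (φ (h, w₀)).1 * k := by
      intro h k
      obtain ⟨u, w, huw, rfl⟩ := hgen k
      rw [← hfib w, hstep h u w huw, hfib u]
    refine ⟨(φ (1, w₀)).1, RelIso.ext fun x => Prod.ext ?_ (htype φ x).symm⟩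
    rw [voltageGraphAutHom_apply, ← hmul, one_mul, ← hfib x.2]

/-- `u` and `w` are types of vertices in a common orbit of the automorphism group. -/
def SameOrbitType (B : SimpleGraph W) (vol : W → W → H) (hvol : ∀ u w, vol w u = (vol u w)⁻¹)
    (u w : W) : Prop :=
  ∃ (φ : voltageGraph B vol hvol ≃g voltageGraph B vol hvol) (h : H), (φ (h, u)).2 = w

theorem SameOrbitType.symm {u w : W} (h : SameOrbitType B vol hvol u w) :
    SameOrbitType B vol hvol w u := by
  obtain ⟨φ, h, rfl⟩ := h
  exact ⟨φ.symm, (φ (h, u)).1, by simp⟩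

/-- Edges lift from the base to the cover, are moved by `φ` and project back, so sharing an orbit is
a bisimulation of the base. -/
theorem SameOrbitType.exists_adj {u w u' : W} (h : SameOrbitType B vol hvol u w)
    (hu : B.Adj u u') : ∃ w', B.Adj w w' ∧ SameOrbitType B vol hvol u' w' := by
  obtain ⟨φ, h, rfl⟩ := h
  have h₁ : (voltageGraph B vol hvol).Adj (h, u) (h * vol u u', u') := ⟨hu, rfl⟩
  exact ⟨_, (φ.map_adj_iff.2 h₁).1, φ, _, rfl⟩

end VoltageGraph

/-! ### The cubic ladder and its triangles -/

/-- The vertices of a ladder with rails `A` and `B`, completed by six further vertices. -/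
inductive LadderVertex (K : ℕ)
  | a | b | d | f | g | j
  | A (i : Fin (K + 2))
  | B (i : Fin (K + 2))

namespace LadderVertex
variable {K : ℕ}

instance : Finite (LadderVertex K) := by
  refine Finite.of_surjective (α := Fin 6 ⊕ Fin (K + 2) ⊕ Fin (K + 2))
    (Sum.elim ![a, b, d, f, g, j] (Sum.elim A B)) ?_
  rintro (_ | _ | _ | _ | _ | _ | i | i)
  exacts [⟨Sum.inl 0, rfl⟩, ⟨Sum.inl 1, rfl⟩, ⟨Sum.inl 2, rfl⟩, ⟨Sum.inl 3, rfl⟩,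
    ⟨Sum.inl 4, rfl⟩, ⟨Sum.inl 5, rfl⟩, ⟨Sum.inr (Sum.inl i), rfl⟩, ⟨Sum.inr (Sum.inr i), rfl⟩]

/-- The edges of the base graph, in one direction each. -/
def Edge : LadderVertex K → LadderVertex K → Prop
  | A i, A k => i.1 + 1 = k.1
  | B i, B k => i.1 + 1 = k.1
  | A i, B k => i.1 = k.1 ∧ 1 ≤ i.1 ∧ i.1 ≤ K
  | a, A i => i.1 = 0
  | b, A i => i.1 = 0
  | d, A i => i.1 = K + 1
  | f, A i => i.1 = K + 1
  | b, B i => i.1 = 0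
  | g, B i => i.1 = 0 ∨ i.1 = K + 1
  | j, B i => i.1 = K + 1
  | a, b => True
  | a, d => True
  | d, f => True
  | f, j => True
  | g, j => True
  | _, _ => False

/-- The base graph: the ends `A 0`, `A (K + 1)` and `B (K + 1)` of the rails lie in the triangles
`{A 0, a, b}`, `{A (K + 1), d, f}` and `{B (K + 1), g, j}`; the rungs are the edges joining
`A i` to `B i` for `1 ≤ i ≤ K`. -/
def graph (K : ℕ) : SimpleGraph (LadderVertex K) where
  Adj u w := Edge u w ∨ Edge w u
  symm := ⟨fun _ _ h => h.symm⟩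
  loopless := ⟨by rintro (_ | _ | _ | _ | _ | _ | i | i) <;> simp [Edge]⟩

theorem graph_adj {u w : LadderVertex K} : (graph K).Adj u w ↔ Edge u w ∨ Edge w u := Iff.rfl

/-- The vertices in a triangle. -/
def Tri : LadderVertex K → Prop
  | A i => i.1 = 0 ∨ i.1 = K + 1
  | B i => i.1 = K + 1
  | _ => True

/-- The vertices in a triangle all whose neighbours are in a triangle. -/
def Deep : LadderVertex K → Prop
  | a => True
  | d => True
  | f => True
  | j => True
  | _ => False

theorem isThreeRegular_graph (hK : 3 ≤ K) : IsThreeRegular (graph K) := by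
  intro u
  rw [Set.ncard_eq_three]
  have hset : ∀ x y z : LadderVertex K, x ≠ y ∧ x ≠ z ∧ y ≠ z →
      (∀ w, (Edge u w ∨ Edge w u) ↔ w = x ∨ w = y ∨ w = z) →
      ∃ x y z, x ≠ y ∧ x ≠ z ∧ y ≠ z ∧ (graph K).neighborSet u = {x, y, z} :=
    fun x y z h h' => ⟨x, y, z, h.1, h.2.1, h.2.2, Set.ext h'⟩
  rcases u with _ | _ | _ | _ | _ | _ | ⟨i, hi⟩ | ⟨i, hi⟩
  · refine hset b d (A ⟨0, by omega⟩) (by simp) ?_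
    rintro (_ | _ | _ | _ | _ | _ | ⟨k, hk⟩ | ⟨k, hk⟩) <;> simp [Edge]
  · refine hset a (A ⟨0, by omega⟩) (B ⟨0, by omega⟩) (by simp) ?_
    rintro (_ | _ | _ | _ | _ | _ | ⟨k, hk⟩ | ⟨k, hk⟩) <;> simp [Edge]
  · refine hset a f (A ⟨K + 1, by omega⟩) (by simp) ?_
    rintro (_ | _ | _ | _ | _ | _ | ⟨k, hk⟩ | ⟨k, hk⟩) <;> simp [Edge]
  · refine hset d j (A ⟨K + 1, by omega⟩) (by simp) ?_
    rintro (_ | _ | _ | _ | _ | _ | ⟨k, hk⟩ | ⟨k, hk⟩) <;> simp [Edge]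
  · refine hset j (B ⟨0, by omega⟩) (B ⟨K + 1, by omega⟩) (by simp) ?_
    rintro (_ | _ | _ | _ | _ | _ | ⟨k, hk⟩ | ⟨k, hk⟩) <;> simp [Edge]
  · refine hset f g (B ⟨K + 1, by omega⟩) (by simp) ?_
    rintro (_ | _ | _ | _ | _ | _ | ⟨k, hk⟩ | ⟨k, hk⟩) <;> simp [Edge]
  · rcases eq_or_ne i 0 with rfl | h₀
    · refine hset a b (A ⟨1, by omega⟩) (by simp) ?_
      rintro (_ | _ | _ | _ | _ | _ | ⟨k, hk⟩ | ⟨k, hk⟩) <;> simp [Edge] <;> omega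
    rcases eq_or_ne i (K + 1) with rfl | h₁
    · refine hset d f (A ⟨K, by omega⟩) (by simp) ?_
      rintro (_ | _ | _ | _ | _ | _ | ⟨k, hk⟩ | ⟨k, hk⟩) <;> simp [Edge] <;> omega
    · refine hset (A ⟨i - 1, by omega⟩) (A ⟨i + 1, by omega⟩) (B ⟨i, hi⟩) (by simp) ?_
      rintro (_ | _ | _ | _ | _ | _ | ⟨k, hk⟩ | ⟨k, hk⟩) <;> simp [Edge] <;> omega
  · rcases eq_or_ne i 0 with rfl | h₀
    · refine hset b g (B ⟨1, by omega⟩) (by simp) ?_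
      rintro (_ | _ | _ | _ | _ | _ | ⟨k, hk⟩ | ⟨k, hk⟩) <;> simp [Edge] <;> omega
    rcases eq_or_ne i (K + 1) with rfl | h₁
    · refine hset g j (B ⟨K, by omega⟩) (by simp) ?_
      rintro (_ | _ | _ | _ | _ | _ | ⟨k, hk⟩ | ⟨k, hk⟩) <;> simp [Edge] <;> omega
    · refine hset (B ⟨i - 1, by omega⟩) (B ⟨i + 1, by omega⟩) (A ⟨i, hi⟩) (by simp) ?_
      rintro (_ | _ | _ | _ | _ | _ | ⟨k, hk⟩ | ⟨k, hk⟩) <;> simp [Edge] <;> omega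

theorem tri_of_inTriangle (hK : 3 ≤ K) {u : LadderVertex K} (h : InTriangle (graph K) u) :
    Tri u := by
  obtain ⟨v, w, h₁, h₂, h₃⟩ := h
  rw [graph_adj] at h₁ h₂ h₃
  rcases u with _ | _ | _ | _ | _ | _ | ⟨i, hi⟩ | ⟨i, hi⟩ <;> try trivial
  all_goals
    rcases v with _ | _ | _ | _ | _ | _ | ⟨k, hk⟩ | ⟨k, hk⟩ <;>
      simp only [Edge, or_false, false_or] at h₁ <;>
    rcases w with _ | _ | _ | _ | _ | _ | ⟨l, hl⟩ | ⟨l, hl⟩ <;>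
      simp only [Edge, Tri, or_false, false_or] at * <;> omega

theorem Deep.tri_of_adj {u w : LadderVertex K} (hu : Deep u) (h : (graph K).Adj u w) : Tri w := by
  rw [graph_adj] at h
  rcases u with _ | _ | _ | _ | _ | _ | i | i <;> rcases w with _ | _ | _ | _ | _ | _ | k | k <;>
    simp [Edge, Deep, Tri] at * <;> simp [h]

theorem Deep.tri {u : LadderVertex K} (hu : Deep u) : Tri u := by
  rcases u with _ | _ | _ | _ | _ | _ | i | i <;> simp [Deep, Tri] at *

theorem exists_adj_not_tri (hK : 3 ≤ K) {u : LadderVertex K} (hu : Tri u) (hd : ¬ Deep u) :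
    ∃ w, (graph K).Adj u w ∧ ¬ Tri w := by
  simp only [graph_adj]
  rcases u with _ | _ | _ | _ | _ | _ | ⟨i, hi⟩ | ⟨i, hi⟩ <;> simp only [Deep, Tri] at hu hd
  · tauto
  · exact ⟨B ⟨0, by omega⟩, by simp [Edge], by simp [Tri]⟩
  · tauto
  · tauto
  · exact ⟨B ⟨0, by omega⟩, by simp [Edge], by simp [Tri]⟩
  · tauto
  · rcases hu with rfl | rfl
    · exact ⟨A ⟨1, by omega⟩, by simp [Edge], by simp [Tri]; omega⟩
    · exact ⟨A ⟨K, by omega⟩, by simp [Edge], by simp [Tri]; omega⟩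
  · subst hu
    exact ⟨B ⟨K, by omega⟩, by simp [Edge], by simp [Tri]⟩

theorem exists_adj_not_deep {u : LadderVertex K} (hu : Tri u) (hd : ¬ Deep u)
    (hne : u ≠ A ⟨K + 1, by omega⟩) : ∃ w, (graph K).Adj u w ∧ Tri w ∧ ¬ Deep w := by
  simp only [graph_adj]
  rcases u with _ | _ | _ | _ | _ | _ | ⟨i, hi⟩ | ⟨i, hi⟩ <;> simp only [Deep, Tri] at hu hd
  · tauto
  · exact ⟨A ⟨0, by omega⟩, by simp [Edge], by simp [Tri], by simp [Deep]⟩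
  · tauto
  · tauto
  · exact ⟨B ⟨K + 1, by omega⟩, by simp [Edge], by simp [Tri], by simp [Deep]⟩
  · tauto
  · rcases hu with rfl | rfl
    · exact ⟨b, by simp [Edge], by simp [Tri], by simp [Deep]⟩
    · exact absurd rfl hne
  · subst hu
    exact ⟨g, by simp [Edge], by simp [Tri], by simp [Deep]⟩

theorem deep_of_adj_last {w : LadderVertex K} (h : (graph K).Adj (A ⟨K + 1, by omega⟩) w)
    (hw : Tri w) (hK : 3 ≤ K) : Deep w := by
  rw [graph_adj] at h
  rcases w with _ | _ | _ | _ | _ | _ | ⟨k, hk⟩ | ⟨k, hk⟩ <;>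
    simp only [Edge, Deep, Tri, or_false, false_or] at * <;> omega

/-! ### Rigidity of the ladder under bisimulations -/

/-- A symmetric bisimulation on the base graph that respects triangles is contained in the
identity. -/
theorem eq_of_bisimulation (hK : 3 ≤ K) {R : LadderVertex K → LadderVertex K → Prop}
    (hsymm : ∀ u w, R u w → R w u) (htri : ∀ u w, R u w → Tri u → Tri w)
    (hadj : ∀ u w u', R u w → (graph K).Adj u u' → ∃ w', (graph K).Adj w w' ∧ R u' w')
    {u w : LadderVertex K} (huw : R u w) : u = w := by
  -- A triangle vertex that is not deep has a neighbour off the triangles, which the bisimulation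
  -- would transfer to a neighbour of the deep vertex.
  have hdeep : ∀ u w, R u w → Deep u → Deep w := by
    intro u w huw hu
    by_contra hw
    obtain ⟨w', hww', hw'⟩ := exists_adj_not_tri hK (htri u w huw hu.tri) hw
    obtain ⟨u', huu', hu'⟩ := hadj w u w' (hsymm _ _ huw) hww'
    exact hw' (htri _ _ (hsymm _ _ hu') (hu.tri_of_adj huu'))
  have hntri : ∀ u w, R u w → ¬ Tri u → ¬ Tri w := fun u w h hu hw =>
    hu (htri w u (hsymm _ _ h) hw)
  have hndeep : ∀ u w, R u w → ¬ Deep u → ¬ Deep w := fun u w h hu hw =>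
    hu (hdeep w u (hsymm _ _ h) hw)
  -- Good vertices are related only to themselves. Goodness spreads along edges: a partner of a
  -- neighbour of a good `v` is again a neighbour of `v` (`hforce`), and it differs from every other
  -- good vertex (`hne`).
  let Good : LadderVertex K → Prop := fun u => ∀ w, R u w → w = u
  have hne : ∀ u v w, Good v → u ≠ v → R u w → w ≠ v := by
    rintro u v w hv huv huw rfl
    exact huv (hv u (hsymm _ _ huw))
  have hforce : ∀ v u, Good v → Edge v u ∨ Edge u v → ∀ w, R u w → Edge v w ∨ Edge w v := by
    intro v u hv hvu w huw
    obtain ⟨v', hwv', hvv'⟩ := hadj u w v huw (SimpleGraph.Adj.symm hvu)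
    rw [hv v' hvv'] at hwv'
    exact hwv'.symm
  -- The starting point: `A (K + 1)` is the only non-deep triangle vertex whose triangle neighbours
  -- are all deep.
  have hA₁ : Good (A ⟨K + 1, by omega⟩) := by
    intro w hw
    have hw₁ := htri _ _ hw (by simp [Tri])
    have hw₂ := hndeep _ _ hw (by simp [Deep])
    by_contra hne
    obtain ⟨w', hww', h₁, h₂⟩ := exists_adj_not_deep hw₁ hw₂ hne
    obtain ⟨u', huu', hu'⟩ := hadj _ _ _ (hsymm _ _ hw) hww'
    exact hndeep _ _ hu' h₂ (deep_of_adj_last huu' (htri _ _ hu' h₁) hK)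
  have hA : Good (A ⟨K, by omega⟩) := by
    intro w hw
    have h₁ := hforce _ _ hA₁ (by simp [Edge]) w hw
    have h₂ := hntri _ _ hw (by simp [Tri]; omega)
    rcases w with _ | _ | _ | _ | _ | _ | ⟨k, hk⟩ | ⟨k, hk⟩ <;> simp [Edge, Tri] at h₁ h₂ ⊢ <;> omega
  have hB : Good (B ⟨K, by omega⟩) := by
    intro w hw
    have h₁ := hforce _ _ hA (by simp [Edge]; omega) w hw
    have h₂ := hntri _ _ hw (by simp [Tri])
    -- The rival candidate is `A (K - 1)`. Unlike `B K` it has no neighbour in a triangle, because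
    -- `K ≥ 3` keeps `A (K - 2)` away from `A 0`.
    obtain ⟨w', h₃, h₄⟩ := hadj _ _ (B ⟨K + 1, by omega⟩) hw (by simp [graph_adj, Edge])
    have h₅ := htri _ _ h₄ (by simp [Tri])
    rw [graph_adj] at h₃
    rcases w with _ | _ | _ | _ | _ | _ | ⟨k, hk⟩ | ⟨k, hk⟩ <;>
      simp only [Edge, Tri, or_false, false_or, not_true] at h₁ h₂
    · rcases w' with _ | _ | _ | _ | _ | _ | ⟨l, hl⟩ | ⟨l, hl⟩ <;>
        simp only [Edge, Tri, or_false, false_or] at h₃ h₅ <;> omega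
    · simp; omega
  have hB₁ : Good (B ⟨K + 1, by omega⟩) := by
    intro w hw
    have h₁ := hforce _ _ hB (by simp [Edge]) w hw
    have h₂ := htri _ _ hw (by simp [Tri])
    rcases w with _ | _ | _ | _ | _ | _ | ⟨k, hk⟩ | ⟨k, hk⟩ <;> simp [Edge, Tri] at h₁ h₂ ⊢ <;> omega
  have hj : Good j := by
    intro w hw
    have h₁ := hforce _ _ hB₁ (by simp [Edge]) w hw
    have h₂ := hdeep _ _ hw (by simp [Deep])
    rcases w with _ | _ | _ | _ | _ | _ | ⟨k, hk⟩ | ⟨k, hk⟩ <;> simp [Edge, Deep] at h₁ h₂ ⊢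
  have hg : Good g := by
    intro w hw
    have h₁ := hforce _ _ hB₁ (by simp [Edge]) w hw
    have h₂ := hndeep _ _ hw (by simp [Deep])
    have h₃ := htri _ _ hw (by simp [Tri])
    rcases w with _ | _ | _ | _ | _ | _ | ⟨k, hk⟩ | ⟨k, hk⟩ <;>
      simp [Edge, Deep, Tri] at h₁ h₂ h₃ ⊢ <;> omega
  have hf : Good f := by
    intro w hw
    have h₁ := hforce _ _ hj (by simp [Edge]) w hw
    have h₂ := hdeep _ _ hw (by simp [Deep])
    rcases w with _ | _ | _ | _ | _ | _ | ⟨k, hk⟩ | ⟨k, hk⟩ <;> simp [Edge, Deep] at h₁ h₂ ⊢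
  have hd : Good d := by
    intro w hw
    have h₁ := hforce _ _ hA₁ (by simp [Edge]) w hw
    have h₂ := hdeep _ _ hw (by simp [Deep])
    have h₃ : w ≠ f := hne _ _ _ hf (by simp) hw
    rcases w with _ | _ | _ | _ | _ | _ | ⟨k, hk⟩ | ⟨k, hk⟩ <;> simp [Edge, Deep] at h₁ h₂ h₃ ⊢
  have ha : Good a := by
    intro w hw
    have h₁ := hforce _ _ hd (by simp [Edge]) w hw
    have h₂ := hdeep _ _ hw (by simp [Deep])
    have h₃ : w ≠ f := hne _ _ _ hf (by simp) hw
    rcases w with _ | _ | _ | _ | _ | _ | ⟨k, hk⟩ | ⟨k, hk⟩ <;> simp [Edge, Deep] at h₁ h₂ h₃ ⊢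
  have hB₀ : Good (B ⟨0, by omega⟩) := by
    intro w hw
    have h₁ := hforce _ _ hg (by simp [Edge]) w hw
    have h₂ := hntri _ _ hw (by simp [Tri])
    rcases w with _ | _ | _ | _ | _ | _ | ⟨k, hk⟩ | ⟨k, hk⟩ <;> simp [Edge, Tri] at h₁ h₂ ⊢ <;> omega
  have hb : Good b := by
    intro w hw
    have h₁ := hforce _ _ ha (by simp [Edge]) w hw
    have h₂ := hforce _ _ hB₀ (by simp [Edge]) w hw
    rcases w with _ | _ | _ | _ | _ | _ | ⟨k, hk⟩ | ⟨k, hk⟩ <;> simp [Edge] at h₁ h₂ ⊢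
    omega
  have hA₀ : Good (A ⟨0, by omega⟩) := by
    intro w hw
    have h₁ := hforce _ _ ha (by simp [Edge]) w hw
    have h₂ : w ≠ b := hne _ _ _ hb (by simp) hw
    have h₃ : w ≠ d := hne _ _ _ hd (by simp) hw
    rcases w with _ | _ | _ | _ | _ | _ | ⟨k, hk⟩ | ⟨k, hk⟩ <;> simp [Edge] at h₁ h₂ h₃ ⊢
    exact h₁
  -- Descent along both rails, keeping two consecutive levels: once three vertices of the closed
  -- neighbourhood of `A (m + 1)` are known to be good, only `A m` is left, and likewise on the
  -- other rail.
  have hrail : ∀ i, i ≤ K → (∀ h : K - i < K + 2, Good (A ⟨K - i, h⟩) ∧ Good (B ⟨K - i, h⟩)) ∧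
      ∀ h : K - i + 1 < K + 2, Good (A ⟨K - i + 1, h⟩) ∧ Good (B ⟨K - i + 1, h⟩) := by
    intro i
    induction i with
    | zero => exact fun _ => ⟨fun _ => ⟨hA, hB⟩, fun _ => ⟨hA₁, hB₁⟩⟩
    | succ i ih =>
      intro hi
      obtain ⟨hlow, hup⟩ := ih (by omega)
      obtain ⟨m, hm⟩ : ∃ m, K - i = m + 1 := ⟨K - i - 1, by omega⟩
      have hm' : K - (i + 1) = m := by omega
      rw [hm']
      rw [hm] at hlow hup
      refine ⟨fun hmK => ⟨fun w hw => ?_, fun w hw => ?_⟩, hlow⟩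
      · have h₁ := hforce _ _ (hlow (by omega)).1 (by simp [Edge]) w hw
        have h₂ : w ≠ A ⟨m + 1 + 1, by omega⟩ := hne _ _ _ (hup (by omega)).1 (by simp; omega) hw
        have h₃ : w ≠ B ⟨m + 1, by omega⟩ := hne _ _ _ (hlow (by omega)).2 (by simp) hw
        rcases w with _ | _ | _ | _ | _ | _ | ⟨k, hk⟩ | ⟨k, hk⟩ <;>
          simp [Edge] at h₁ h₂ h₃ ⊢ <;> omega
      · have h₁ := hforce _ _ (hlow (by omega)).2 (by simp [Edge]) w hw
        have h₂ : w ≠ B ⟨m + 1 + 1, by omega⟩ := hne _ _ _ (hup (by omega)).2 (by simp; omega) hw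
        have h₃ : w ≠ A ⟨m + 1, by omega⟩ := hne _ _ _ (hlow (by omega)).1 (by simp) hw
        rcases w with _ | _ | _ | _ | _ | _ | ⟨k, hk⟩ | ⟨k, hk⟩ <;>
          simp [Edge] at h₁ h₂ h₃ ⊢ <;> omega
  have hall : ∀ i : Fin (K + 2), Good (A i) ∧ Good (B i) := by
    rintro ⟨i, hi⟩
    rcases eq_or_ne i (K + 1) with rfl | h
    · exact ⟨hA₁, hB₁⟩
    · have := (hrail (K - i) (by omega)).1 (by omega)
      simpa only [show K - (K - i) = i by omega] using this
  refine (?_ : Good u) w huw |>.symm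
  rcases u with _ | _ | _ | _ | _ | _ | i | i
  exacts [ha, hb, hd, hf, hg, hj, (hall i).1, (hall i).2]

/-! ### Voltages on the rungs -/

variable {H : Type*} [Group H]

/-- The voltage of the rung from `A i` to `B i` is `s i`; the other edges have trivial voltage. -/
def voltage (s : ℕ → H) : LadderVertex K → LadderVertex K → H
  | A i, B _ => s i.1
  | B _, A i => (s i.1)⁻¹
  | _, _ => 1

theorem voltage_symm (s : ℕ → H) (u w : LadderVertex K) : voltage s w u = (voltage s u w)⁻¹ := by
  rcases u with _ | _ | _ | _ | _ | _ | i | i <;> rcases w with _ | _ | _ | _ | _ | _ | k | k <;>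
    simp [voltage]

/-- The triangles of the base avoid the rungs, so all their voltages are trivial and they lift to
triangles of the cover. -/
theorem inTriangle_voltageGraph (s : ℕ → H) (x : H × LadderVertex K) (hx : Tri x.2) :
    InTriangle (voltageGraph (graph K) (voltage s) (voltage_symm s)) x := by
  suffices ∃ u w, ((graph K).Adj x.2 u ∧ (graph K).Adj x.2 w ∧ (graph K).Adj u w) ∧
      voltage s x.2 u = 1 ∧ voltage s x.2 w = 1 ∧ voltage s u w = 1 by
    obtain ⟨u, w, ⟨h₁, h₂, h₃⟩, h₄, h₅, h₆⟩ := this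
    exact ⟨(x.1, u), (x.1, w), ⟨h₁, by simp [h₄]⟩, ⟨h₂, by simp [h₅]⟩, h₃, by simp [h₆]⟩
  obtain ⟨h, _ | _ | _ | _ | _ | _ | ⟨i, hi⟩ | ⟨i, hi⟩⟩ := x
  · exact ⟨b, A ⟨0, by omega⟩, by simp [graph_adj, Edge], by simp [voltage]⟩
  · exact ⟨a, A ⟨0, by omega⟩, by simp [graph_adj, Edge], by simp [voltage]⟩
  · exact ⟨f, A ⟨K + 1, by omega⟩, by simp [graph_adj, Edge], by simp [voltage]⟩
  · exact ⟨d, A ⟨K + 1, by omega⟩, by simp [graph_adj, Edge], by simp [voltage]⟩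
  · exact ⟨j, B ⟨K + 1, by omega⟩, by simp [graph_adj, Edge], by simp [voltage]⟩
  · exact ⟨g, B ⟨K + 1, by omega⟩, by simp [graph_adj, Edge], by simp [voltage]⟩
  · rcases hx with rfl | rfl
    · exact ⟨a, b, by simp [graph_adj, Edge], by simp [voltage]⟩
    · exact ⟨d, f, by simp [graph_adj, Edge], by simp [voltage]⟩
  · obtain rfl : i = K + 1 := hx
    exact ⟨g, j, by simp [graph_adj, Edge], by simp [voltage]⟩

/-- Lying in a triangle passes to the cover and back, so `SameOrbitType` respects triangles and
rigidity of the base applies. -/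
theorem aut_snd (hK : 3 ≤ K) (s : ℕ → H)
    (φ : voltageGraph (graph K) (voltage s) (voltage_symm s) ≃g
      voltageGraph (graph K) (voltage s) (voltage_symm s)) (x : H × LadderVertex K) :
    (φ x).2 = x.2 := by
  refine (eq_of_bisimulation hK
    (R := SameOrbitType (graph K) (voltage s) (voltage_symm s))
    (fun _ _ h => h.symm) ?_ (fun _ _ _ h h' => h.exists_adj h') ⟨φ, x.1, rfl⟩).symm
  rintro u w ⟨φ, h, rfl⟩ hu
  exact tri_of_inTriangle hK
    ((inTriangle_voltageGraph s (h, u) hu).map φ.toHom).of_voltageGraph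

theorem voltage_connected (s : ℕ → H) (P : LadderVertex K → Prop) (hP : P b)
    (hstep : ∀ u w, (graph K).Adj u w → voltage s u w = 1 → P u → P w) (w : LadderVertex K) :
    P w := by
  have hA : ∀ i (hi : i < K + 2), P (A ⟨i, hi⟩) := by
    intro i
    induction i with
    | zero => exact fun hi => hstep b _ (by simp [graph_adj, Edge]) rfl hP
    | succ i ih =>
      exact fun hi => hstep _ _ (by simp [graph_adj, Edge]) rfl (ih (by omega))
  have hB : ∀ i (hi : i < K + 2), P (B ⟨i, hi⟩) := by
    intro i
    induction i with
    | zero => exact fun hi => hstep b _ (by simp [graph_adj, Edge]) rfl hP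
    | succ i ih =>
      exact fun hi => hstep _ _ (by simp [graph_adj, Edge]) rfl (ih (by omega))
  have hA' := hA (K + 1) (by omega)
  have hB' := hB (K + 1) (by omega)
  rcases w with _ | _ | _ | _ | _ | _ | ⟨i, hi⟩ | ⟨i, hi⟩
  · exact hstep b _ (by simp [graph_adj, Edge]) rfl hP
  · exact hP
  · exact hstep _ _ (by simp [graph_adj, Edge]) rfl hA'
  · exact hstep _ _ (by simp [graph_adj, Edge]) rfl hA'
  · exact hstep _ _ (by simp [graph_adj, Edge]) rfl hB'
  · exact hstep _ _ (by simp [graph_adj, Edge]) rfl hB'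
  · exact hA i hi
  · exact hB i hi

theorem voltageGraphAutHom_bijective (hK : 3 ≤ K) (s : ℕ → H)
    (hs : ∀ h, ∃ i, 1 ≤ i ∧ i ≤ K ∧ s i = h) :
    Function.Bijective (voltageGraphAutHom (graph K) (voltage s) (voltage_symm s)) := by
  refine _root_.voltageGraphAutHom_bijective b (aut_snd hK s) (voltage_connected s) fun h => ?_
  obtain ⟨i, h₁, h₂, rfl⟩ := hs h
  exact ⟨A ⟨i, by omega⟩, B ⟨i, by omega⟩, by simp [graph_adj, Edge, h₁, h₂], rfl⟩

end LadderVertex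

/-! ### Assembly -/

/-- Isomorphic graphs have isomorphic automorphism groups. -/
def SimpleGraph.Iso.autCongr {V V' : Type*} {Γ : SimpleGraph V} {Γ' : SimpleGraph V'}
    (e : Γ ≃g Γ') : (Γ ≃g Γ) ≃* (Γ' ≃g Γ') where
  toFun φ := (e.symm.trans φ).trans e
  invFun φ := (e.trans φ).trans e.symm
  left_inv φ := RelIso.ext fun x => by simp
  right_inv φ := RelIso.ext fun x => by simp
  map_mul' φ ψ := RelIso.ext fun x => by simp

theorem IsThreeRegular.map_iso {V V' : Type*} {Γ : SimpleGraph V} {Γ' : SimpleGraph V'}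
    (e : Γ ≃g Γ') (h : IsThreeRegular Γ) : IsThreeRegular Γ' := by
  intro v
  obtain ⟨v, rfl⟩ := e.surjective v
  rw [← h v, ← Set.ncard_image_of_injective _ e.injective]
  congr 1
  ext w
  obtain ⟨w, rfl⟩ := e.surjective w
  rw [e.injective.mem_set_image, SimpleGraph.mem_neighborSet, SimpleGraph.mem_neighborSet,
    e.map_adj_iff]

/-- Frucht's theorem for cubic graphs. -/
theorem exists_isThreeRegular_aut (H : Type*) [Group H] [Finite H] :
    ∃ (n : ℕ) (Δ : SimpleGraph (Fin n)),
      6 ≤ n ∧ IsThreeRegular Δ ∧ Nonempty ((Δ ≃g Δ) ≃* H) := by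
  obtain ⟨m, ⟨e⟩⟩ := Finite.exists_equiv_fin H
  -- Rungs are numbered from `1`, hence the shift; `m` rungs list `H`, and the spare ones, which
  -- secure `K ≥ 3`, get the value `1`.
  let s : ℕ → H := fun i => if h : i - 1 < m then e.symm ⟨i - 1, h⟩ else 1
  have hs : ∀ h, ∃ i, 1 ≤ i ∧ i ≤ m + 3 ∧ s i = h := fun h =>
    ⟨e h + 1, by omega, by omega, by simp [s]⟩
  have hbij := LadderVertex.voltageGraphAutHom_bijective (by omega : 3 ≤ m + 3) s hs
  obtain ⟨n, ⟨e'⟩⟩ := Finite.exists_equiv_fin (H × LadderVertex (m + 3))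
  let Γ := voltageGraph (LadderVertex.graph (m + 3)) (LadderVertex.voltage s)
    (LadderVertex.voltage_symm s)
  let iso : Γ ≃g Γ.map e'.toEmbedding := SimpleGraph.Iso.map e' Γ
  refine ⟨n, _, ?_, (isThreeRegular_voltageGraph (LadderVertex.isThreeRegular_graph
    (by omega))).map_iso iso, ⟨iso.autCongr.symm.trans (MulEquiv.ofBijective _ hbij).symm⟩⟩
  -- The `m + 5` vertices of the rail `A` and the vertex `a`, all over `1 : H`, already give `6 ≤
  -- n`.
  have hinj : Function.Injective fun i : Fin (m + 3 + 2) ⊕ Unit =>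
      e' (1, Sum.elim LadderVertex.A (fun _ => LadderVertex.a) i) := by
    rintro (i | i) (k | k) h <;> simp at h ⊢
    exact h
  have := Fintype.card_le_of_injective _ hinj
  simp at this
  omega

theorem mainTheorem3 (H : Type*) [Group H] [Finite H] :
    -- `H` is the automorphism group of an MB-homogeneous (countably infinite) graph
    (∃ Γ : SimpleGraph ℕ, IsMBHomogeneous Γ ∧ Nonempty ((Γ ≃g Γ) ≃* H)) ∧
    -- there is a 3-regular graph with at least 6 vertices and automorphism group `H`
    (∃ (n : ℕ) (Δ : SimpleGraph (Fin n)),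
      6 ≤ n ∧ IsThreeRegular Δ ∧ Nonempty ((Δ ≃g Δ) ≃* H)) ∧
    -- laying any such graph onto the initial independent block gives a graph as required
    (∀ (n : ℕ) (Δ : SimpleGraph (Fin n)),
      6 ≤ n → IsThreeRegular Δ → Nonempty ((Δ ≃g Δ) ≃* H) →
        IsMBHomogeneous (overlayGraph Δ) ∧
          Nonempty ((overlayGraph Δ ≃g overlayGraph Δ) ≃* H)) ∧
    -- `H` is the group of units of an oligomorphic permutation monoid
    (∃ T : Submonoid (Equiv.Perm ℕ), IsOligomorphic T ∧ Nonempty (Tˣ ≃* H)) := by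
  have overlay : ∀ (n : ℕ) (Δ : SimpleGraph (Fin n)),
      6 ≤ n → IsThreeRegular Δ → Nonempty ((Δ ≃g Δ) ≃* H) →
        IsMBHomogeneous (overlayGraph Δ) ∧
          Nonempty ((overlayGraph Δ ≃g overlayGraph Δ) ≃* H) :=
    fun n Δ hn hΔ ⟨e⟩ => ⟨overlayGraph_isMBHomogeneous Δ,
      ⟨(MulEquiv.ofBijective _ (overlayAutHom_bijective hn hΔ)).symm.trans e⟩⟩
  obtain ⟨n, Δ, hn, hΔ, e⟩ := exists_isThreeRegular_aut H
  obtain ⟨hhom, ⟨e'⟩⟩ := overlay n Δ hn hΔ e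
  exact ⟨⟨_, hhom, ⟨e'⟩⟩, ⟨n, Δ, hn, hΔ, e⟩, overlay,
    _, hhom.isOligomorphic, ⟨(bimorphismUnitsEquiv _).trans e'⟩⟩
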